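/- Let $n\ge 1$ and let $K_n$ be the complete graph on $n$ vertices. The bunkbed graph of $K_n$ is the graph $G=(V,E)$ whose vertices are the pairs $(x,i)$ with $x$ a vertex of $K_n$ and $i\in\{0,1\}$, and whose edges are the pairs $\{(x,i),(y,i)\}$ with $x\ne y$ and $i\in\{0,1\}$, together with the vertical edges $\{(x,0),(x,1)\}$ for all vertices $x$ of $K_n$. Let each edge of $G$ be open with probability $1/2$ and closed with probability $1/2$, independently of all other edges; write $\mathbb{P}_{1/2}$ for the resulting product probability measure on $\{0,1\}^E$, and write $u\leftrightarrow v$ for the event that there is a path of open edges from $u$ to $v$, where $u\leftrightarrow u$ always holds. Then for all vertices $x,y$ of $K_n$, $$\mathbb{P}_{1/2}\big((x,0)\leftrightarrow(y,0)\big)\ \ge\ \mathbb{P}_{1/2}\big((x,0)\leftrightarrow(y,1)\big).$$ -/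

import Mathlib

open MeasureTheory ProbabilityTheory

/-- The bunkbed graph of `G`: two copies of `G`, the lower level `(x, 0)` and the upper level
`(x, 1)`, together with all vertical edges joining `(x, 0)` to `(x, 1)`. -/
def bunkbed {V : Type*} (G : SimpleGraph V) : SimpleGraph (V × Fin 2) where
  Adj u v := (G.Adj u.1 v.1 ∧ u.2 = v.2) ∨ (u.1 = v.1 ∧ u.2 ≠ v.2)
  symm := ⟨fun _ _ h => h.imp (fun h => ⟨h.1.symm, h.2.symm⟩) (fun h => ⟨h.1.symm, h.2.symm⟩)⟩
  loopless := ⟨fun _ h => h.elim (fun h => G.irrefl h.1) (fun h => h.2 rfl)⟩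

/-- A bond configuration: each edge of `G` is open (`true`) or closed (`false`). -/
abbrev BondConfig {V : Type*} (G : SimpleGraph V) : Type _ := G.edgeSet → Bool

/-- The law of independent bond percolation on `G` with parameter `p`: the product measure under
which each edge is open with probability `p` and closed with probability `1 - p`. -/
noncomputable def bondPercolation {V : Type*} (G : SimpleGraph V) (p : unitInterval) :
    Measure (BondConfig G) :=
  Measure.infinitePi fun _ : G.edgeSet => bernoulliMeasure true false p

/-- The subgraph of `G` formed by all its vertices and the open edges of `ω`. -/
def openSubgraph {V : Type*} (G : SimpleGraph V) (ω : BondConfig G) : SimpleGraph V :=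
  SimpleGraph.fromEdgeSet {e | ∃ h : e ∈ G.edgeSet, ω ⟨e, h⟩ = true}

/-- The event `u ↔ v`: there is a path of open edges from `u` to `v` (possibly of length `0`). -/
def connectionEvent {V : Type*} (G : SimpleGraph V) (u v : V) : Set (BondConfig G) :=
  {ω | (openSubgraph G ω).Reachable u v}

/-! At parameter 1/2 all configurations are equally likely, so the claim compares cardinalities, and
it is proved separately for each set `H` of open vertical edges. The two levels are then independent
uniform graphs `G₀`, `G₁` on the vertices. If x = y, or if x or y lies in `H`, a symmetry suffices.

Otherwise label each vertex, on each level, by the set of vertices of `H` in its component there. A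
labelling is realised by a product over its fibres: connected graphs on a fibre with nonempty label,
arbitrary graphs on the fibre with label ∅. Both counts are log-convex in the size of the fibre, so,
given the other labels, the labels of x and y have a joint law that is a product plus a nonnegative
diagonal (`exists_card_label_eq_mul_add`). They are thus exchangeable, and more likely to fall in
one class together than two independent copies are (`IsProductPlusDiagonal.card_sq_le`).

The labels of the vertices of `H` on both levels generate a partition of `H`, symmetric in the
levels. A path from (x,0) to (y,1) forces the label of x in `G₀` and that of y in `G₁` into the same
class; if the labels of x and y in `G₀` share a class, (x,0) and (y,0) are joined. Correlation
within a level and AM-GM over the exchange of levels (`card_same_class_le`) conclude. -/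

/-! ### Log-convexity of the number of connected labelled graphs. -/

namespace SimpleGraph

/-- The number of preconnected simple graphs on `n` labelled vertices. -/
noncomputable def preconnectedCount (n : ℕ) : ℕ :=
  Nat.card {G : SimpleGraph (Fin n) // G.Preconnected}

theorem card_preconnected (α : Type*) [Finite α] :
    Nat.card {G : SimpleGraph α // G.Preconnected} = preconnectedCount (Nat.card α) := by
  have e := Finite.equivFin α
  refine Nat.card_congr (Equiv.subtypeEquiv e.simpleGraph fun G => ?_)
  exact (Iso.comap e.symm G).symm.preconnected_iff

theorem card_simpleGraph (α : Type*) [Finite α] :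
    Nat.card (SimpleGraph α) = Nat.card (SimpleGraph (Fin (Nat.card α))) :=
  Nat.card_congr (Finite.equivFin α).simpleGraph

/-- The extension of a graph by one new vertex with neighbourhood `S`. -/
def extend {α : Type*} (G : SimpleGraph α) (S : Set α) : SimpleGraph (Option α) where
  Adj u v := match u, v with
    | some a, some b => G.Adj a b
    | none, some b => b ∈ S
    | some a, none => a ∈ S
    | none, none => False
  symm := ⟨fun u v h => by cases u <;> cases v <;> simp_all [G.adj_comm]⟩
  loopless := ⟨fun u h => by cases u <;> simp_all⟩

/-- A graph with a distinguished vertex is the graph on the other vertices together with the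
neighbourhood of that vertex. -/
def extendEquiv (α : Type*) : SimpleGraph α × Set α ≃ SimpleGraph (Option α) where
  toFun p := p.1.extend p.2
  invFun G := (G.comap some, {a | G.Adj none (some a)})
  left_inv p := by
    ext <;> simp [extend]
  right_inv G := by
    ext u v
    cases u <;> cases v <;> simp [extend, G.adj_comm]

theorem card_simpleGraph_fin_succ (n : ℕ) :
    Nat.card (SimpleGraph (Fin (n + 1))) = 2 ^ n * Nat.card (SimpleGraph (Fin n)) := by
  have h := Nat.card_congr (extendEquiv (Fin n))
  rw [card_simpleGraph (Option (Fin n)), Nat.card_prod] at h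
  have h1 : Nat.card (Option (Fin n)) = n + 1 := by simp
  have h2 : Nat.card (Set (Fin n)) = 2 ^ n := by
    simp [Nat.card_eq_fintype_card]
  rw [h1, h2] at h
  rw [← h, mul_comm]

theorem Preconnected.extend {α : Type*} {G : SimpleGraph α} (hG : G.Preconnected) {S : Set α}
    (hS : S.Nonempty) : (G.extend S).Preconnected := by
  obtain ⟨s, hs⟩ := hS
  let f : G →g G.extend S := ⟨some, fun h => h⟩
  have h : ∀ u, (G.extend S).Reachable u (some s) := by
    rintro (_ | a)
    · exact Adj.reachable (show s ∈ S from hs)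
    · exact (hG a s).map f
  exact fun u v => (h u).trans (h v).symm

/-- Joining a new vertex to any nonempty set of old vertices keeps a connected graph connected. -/
theorem mul_preconnectedCount_le (n : ℕ) :
    (2 ^ n - 1) * preconnectedCount n ≤ preconnectedCount (n + 1) := by
  have h1 : preconnectedCount (n + 1) =
      Nat.card {G : SimpleGraph (Option (Fin n)) // G.Preconnected} := by
    rw [card_preconnected]; simp
  have h2 : Nat.card {S : Set (Fin n) // S.Nonempty} = 2 ^ n - 1 := by
    have := Set.ncard_compl ({∅} : Set (Set (Fin n)))
    rw [Set.ncard_singleton, Nat.card_eq_fintype_card, Fintype.card_set, Fintype.card_fin] at this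
    rw [← this, ← Nat.card_coe_set_eq]
    exact Nat.card_congr (Equiv.subtypeEquivRight fun S => by simp [Set.nonempty_iff_ne_empty])
  rw [h1, ← h2, preconnectedCount, ← Nat.card_prod]
  refine Nat.card_le_card_of_injective
    (fun p => ⟨p.2.1.extend p.1.1, p.2.2.extend p.1.2⟩) ?_
  rintro ⟨⟨S, hS⟩, ⟨G, hG⟩⟩ ⟨⟨T, hT⟩, ⟨G', hG'⟩⟩ h
  have := (extendEquiv (Fin n)).injective (a₁ := (G, S)) (a₂ := (G', T)) (congrArg Subtype.val h)
  simp_all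

/-- The cut criterion makes connectedness decidable by finite enumeration, for the small counts
below. -/
theorem preconnected_iff_forall_cut {α : Type*} [Fintype α] [DecidableEq α] (G : SimpleGraph α) :
    G.Preconnected ↔
      ∀ S : Finset α, S.Nonempty → Sᶜ.Nonempty → ∃ a ∈ S, ∃ b ∈ Sᶜ, G.Adj a b := by
  classical
  constructor
  · rintro h S ⟨a, ha⟩ ⟨b, hb⟩
    obtain ⟨p⟩ := h a b
    obtain ⟨d, -, h1, h2⟩ := p.exists_boundary_dart (S : Set α) ha (by simpa using hb)
    exact ⟨d.fst, h1, d.snd, by simpa using h2, d.adj⟩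
  · intro h u v
    by_contra huv
    obtain ⟨a, ha, b, hb, hab⟩ := h (Finset.univ.filter fun w => G.Reachable u w)
      ⟨u, by simp⟩ ⟨v, by simpa using huv⟩
    simp only [Finset.mem_compl, Finset.mem_filter, Finset.mem_univ, true_and] at ha hb
    exact hb (ha.trans hab.reachable)

/-- The graph on `Fin n` whose edges are the pairs `i < j` selected by `b`. -/
def ofUpper {n : ℕ} (b : {p : Fin n × Fin n // p.1 < p.2} → Bool) : SimpleGraph (Fin n) where
  Adj i j := (∃ h : i < j, b ⟨(i, j), h⟩ = true) ∨ (∃ h : j < i, b ⟨(j, i), h⟩ = true)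
  symm := ⟨fun _ _ h => h.symm⟩
  loopless := ⟨fun i h => by simp at h⟩

instance {n : ℕ} (b : {p : Fin n × Fin n // p.1 < p.2} → Bool) : DecidableRel (ofUpper b).Adj :=
  fun _ _ => inferInstanceAs (Decidable (_ ∨ _))

theorem ofUpper_bijective (n : ℕ) : Function.Bijective (ofUpper (n := n)) := by
  classical
  constructor
  · intro b c h
    funext ⟨⟨i, j⟩, hij⟩
    have := congrArg (fun G => G.Adj i j) h
    have hij : i < j := hij
    simp only [ofUpper, hij, not_lt_of_gt hij, exists_true_left, IsEmpty.exists_iff, or_false,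
      eq_iff_iff] at this
    exact Bool.eq_iff_iff.2 this
  · intro G
    refine ⟨fun p => decide (G.Adj p.1.1 p.1.2), ?_⟩
    ext i j
    rcases lt_trichotomy i j with h | h | h
    · simp [ofUpper, h, not_lt_of_gt h]
    · simp [ofUpper, h]
    · simp [ofUpper, h, not_lt_of_gt h, G.adj_comm]

theorem preconnectedCount_eq_card_ofUpper (n : ℕ) :
    preconnectedCount n = Fintype.card {b : {p : Fin n × Fin n // p.1 < p.2} → Bool //
      ∀ S : Finset (Fin n), S.Nonempty → Sᶜ.Nonempty → ∃ i ∈ S, ∃ j ∈ Sᶜ, (ofUpper b).Adj i j} := by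
  rw [preconnectedCount, ← Nat.card_eq_fintype_card]
  refine (Nat.card_congr (Equiv.subtypeEquiv (Equiv.ofBijective _ (ofUpper_bijective n))
    fun b => ?_)).symm
  exact (preconnected_iff_forall_cut _).symm

/-- With the value 1, labels carried by no vertex contribute a trivial factor in `card_label_eq`. -/
theorem preconnectedCount_zero : preconnectedCount 0 = 1 := by
  rw [preconnectedCount_eq_card_ofUpper]; decide +kernel

theorem preconnectedCount_one : preconnectedCount 1 = 1 := by
  rw [preconnectedCount_eq_card_ofUpper]; decide +kernel

theorem preconnectedCount_two : preconnectedCount 2 = 1 := by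
  rw [preconnectedCount_eq_card_ofUpper]; decide +kernel

theorem preconnectedCount_three : preconnectedCount 3 = 4 := by
  rw [preconnectedCount_eq_card_ofUpper]; decide +kernel

set_option maxRecDepth 100000 in
theorem preconnectedCount_four : preconnectedCount 4 = 38 := by
  rw [preconnectedCount_eq_card_ofUpper]; decide +kernel

theorem preconnectedCount_le (n : ℕ) :
    preconnectedCount n ≤ Nat.card (SimpleGraph (Fin n)) :=
  Nat.card_le_card_of_injective _ Subtype.val_injective

theorem preconnectedCount_pos (n : ℕ) : 0 < preconnectedCount n := by
  have : Nonempty {G : SimpleGraph (Fin n) // G.Preconnected} := ⟨⟨⊤, preconnected_top⟩⟩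
  exact Nat.card_pos

/-- The connected proportion is 38/64 on 4 vertices, and passing from m to m + 1 vertices multiplies
it by at least 1 - 2^(-m). The product of these factors stays above 7/8 + 2^(-(n+3)), so the
proportion stays above 38/64 · 7/8 > 1/2. -/
theorem card_simpleGraph_fin_le_preconnectedCount (n : ℕ) :
    38 * (7 * 2 ^ (n + 3) + 8) * Nat.card (SimpleGraph (Fin (n + 4))) ≤
      64 * 8 * 2 ^ (n + 3) * preconnectedCount (n + 4) := by
  induction n with
  | zero =>
    rw [preconnectedCount_four, card_simpleGraph_fin_succ, card_simpleGraph_fin_succ,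
      card_simpleGraph_fin_succ, card_simpleGraph_fin_succ]
    simp
  | succ n ih =>
    have h1 := mul_preconnectedCount_le (n + 4)
    rw [show n + 1 + 4 = n + 4 + 1 by ring, card_simpleGraph_fin_succ]
    set t := Nat.card (SimpleGraph (Fin (n + 4)))
    set c := preconnectedCount (n + 4)
    set c' := preconnectedCount (n + 4 + 1)
    obtain ⟨k, hk⟩ : ∃ k, 2 ^ n = k + 1 := ⟨2 ^ n - 1, by have := Nat.one_le_two_pow (n := n); omega⟩
    have e4 : 2 ^ (n + 4) = 16 * k + 16 := by rw [pow_add, hk]; ring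
    have e3 : 2 ^ (n + 3) = 8 * k + 8 := by rw [pow_add, hk]; ring
    rw [e4, show 16 * k + 16 - 1 = 16 * k + 15 by omega] at h1
    rw [e3] at ih
    rw [show n + 1 + 3 = n + 4 by ring, e4]
    have : (16 * k + 15) * (38 * (7 * (8 * k + 8) + 8) * t) ≤ 64 * 8 * (8 * k + 8) * c' :=
      calc _ ≤ (16 * k + 15) * (64 * 8 * (8 * k + 8) * c) := Nat.mul_le_mul_left _ ih
        _ = 64 * 8 * (8 * k + 8) * ((16 * k + 15) * c) := by ring
        _ ≤ _ := Nat.mul_le_mul_left _ h1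
    -- With e = 1/(16k+16) this is 7/8 + e ≤ (1 - e)(7/8 + 2e), valid for e ≤ 1/16 and an equality
    -- at k = 0.
    have h2 : (16 * k + 16) * (38 * (7 * (16 * k + 16) + 8) * t) ≤
        2 * ((16 * k + 15) * (38 * (7 * (8 * k + 8) + 8) * t)) := by
      have : 0 ≤ k * t := Nat.zero_le _
      nlinarith
    nlinarith

/-- Write c for the count. Since c(m+2) ≥ (2^(m+1) - 1) c(m+1), it suffices that c(m+1) ≤ (2^(m+1) -
1) c(m). Bounding c(m+1) by the number of all graphs, this needs a connected proportion of at least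
2^m/(2^(m+1) - 1), barely above 1/2, which holds from m = 4 on. -/
theorem preconnectedCount_sq_le (n : ℕ) :
    preconnectedCount (n + 1) ^ 2 ≤ preconnectedCount (n + 2) * preconnectedCount n := by
  match n with
  | 0 => simp [preconnectedCount_zero, preconnectedCount_one, preconnectedCount_two]
  | 1 => simp [preconnectedCount_one, preconnectedCount_two, preconnectedCount_three]
  | 2 => simp [preconnectedCount_two, preconnectedCount_three, preconnectedCount_four]
  | 3 =>
    have := mul_preconnectedCount_le 4
    simp only [Nat.reduceAdd, preconnectedCount_four, preconnectedCount_three] at this ⊢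
    omega
  | n + 4 =>
    have h0 := mul_preconnectedCount_le (n + 5)
    have h1 := card_simpleGraph_fin_le_preconnectedCount n
    have h2 := preconnectedCount_le (n + 5)
    rw [card_simpleGraph_fin_succ] at h2
    show preconnectedCount (n + 5) ^ 2 ≤ preconnectedCount (n + 6) * preconnectedCount (n + 4)
    change _ ≤ preconnectedCount (n + 6) at h0
    set t := Nat.card (SimpleGraph (Fin (n + 4)))
    set c := preconnectedCount (n + 4)
    set c' := preconnectedCount (n + 5)
    obtain ⟨k, hk⟩ : ∃ k, 2 ^ n = k + 1 := ⟨2 ^ n - 1, by have := Nat.one_le_two_pow (n := n); omega⟩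
    have e3 : 2 ^ (n + 3) = 8 * k + 8 := by rw [pow_add, hk]; ring
    have e4 : 2 ^ (n + 4) = 16 * k + 16 := by rw [pow_add, hk]; ring
    have e5 : 2 ^ (n + 5) = 32 * k + 32 := by rw [pow_add, hk]; ring
    rw [e5, show 32 * k + 32 - 1 = 32 * k + 31 by omega] at h0
    rw [e3] at h1
    rw [e4] at h2
    have h3 : c' ≤ (32 * k + 31) * c := by
      refine h2.trans ?_
      have h4 : 64 * 8 * (8 * k + 8) * ((16 * k + 16) * t) ≤
          64 * 8 * (8 * k + 8) * ((32 * k + 31) * c) := by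
        calc 64 * 8 * (8 * k + 8) * ((16 * k + 16) * t)
            ≤ (32 * k + 31) * (38 * (7 * (8 * k + 8) + 8) * t) := by nlinarith
          _ ≤ (32 * k + 31) * (64 * 8 * (8 * k + 8) * c) := Nat.mul_le_mul_left _ h1
          _ = _ := by ring
      exact Nat.le_of_mul_le_mul_left h4 (by positivity)
    calc c' ^ 2 = c' * c' := sq _
      _ ≤ (32 * k + 31) * c * c' := Nat.mul_le_mul_right _ h3
      _ = ((32 * k + 31) * c') * c := by ring
      _ ≤ _ := Nat.mul_le_mul_right _ h0

theorem card_simpleGraph_fin_sq_le (n : ℕ) :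
    Nat.card (SimpleGraph (Fin (n + 1))) ^ 2 ≤
      Nat.card (SimpleGraph (Fin (n + 2))) * Nat.card (SimpleGraph (Fin n)) := by
  rw [card_simpleGraph_fin_succ (n + 1), card_simpleGraph_fin_succ n]
  calc _ ≤ 2 * (2 ^ n * Nat.card (SimpleGraph (Fin n))) ^ 2 := by omega
    _ = _ := by ring

end SimpleGraph

/-! ### Counting graphs with prescribed labels. -/

namespace SimpleGraph

variable {V : Type*}

/-- A graph without edges between different fibres of `f` is the family of its restrictions to the
fibres. -/
def fiberEquiv {I : Type*} (f : V → I) :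
    {G : SimpleGraph V // ∀ u v, G.Adj u v → f u = f v} ≃ ∀ k, SimpleGraph {v // f v = k} where
  toFun G k := G.1.comap Subtype.val
  invFun F :=
    ⟨{ Adj := fun u v => ∃ h : f v = f u, (F (f u)).Adj ⟨u, rfl⟩ ⟨v, h⟩
       symm := ⟨by
        rintro u v ⟨h, h'⟩
        refine ⟨h.symm, ?_⟩
        have : ∀ k (hu : f u = k) (hv : f v = k), (F k).Adj ⟨u, hu⟩ ⟨v, hv⟩ →
            (F (f v)).Adj ⟨v, rfl⟩ ⟨u, h.symm⟩ := by
          rintro k hu rfl h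
          exact h.symm
        exact this _ rfl h h'⟩
       loopless := ⟨fun u ⟨_, h⟩ => (F (f u)).irrefl h⟩ },
      fun _ _ h => h.1.symm⟩
  left_inv G := by
    ext u v
    simp only [comap_adj]
    exact ⟨fun h => h.2, fun h => ⟨(G.2 _ _ h).symm, h⟩⟩
  right_inv F := by
    ext k ⟨u, hu⟩ ⟨v, hv⟩
    subst hu
    simp [hv]

theorem Reachable.comap_of_fiber {I : Type*} {f : V → I} {G : SimpleGraph V}
    (hf : ∀ u v, G.Adj u v → f u = f v) {k : I} {u v : V} (hu : f u = k) (hv : f v = k)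
    (h : G.Reachable u v) :
    (G.comap (Subtype.val : {v // f v = k} → V)).Reachable ⟨u, hu⟩ ⟨v, hv⟩ := by
  obtain ⟨p⟩ := h
  induction p with
  | nil => exact .rfl
  | cons h p ih =>
    have hw := (hf _ _ h).symm.trans hu
    exact (Adj.reachable (show (G.comap Subtype.val).Adj ⟨_, hu⟩ ⟨_, hw⟩ from h)).trans (ih hw hv)

theorem eq_of_reachable {I : Type*} {f : V → I} {G : SimpleGraph V}
    (hf : ∀ u v, G.Adj u v → f u = f v) {u v : V} (h : G.Reachable u v) : f u = f v := by
  obtain ⟨p⟩ := h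
  induction p with
  | nil => rfl
  | cons h p ih => exact (hf _ _ h).trans ih

/-- The necessary and sufficient condition for a function to be of the form `label H G`. -/
def IsLabelling (H : Finset V) (f : V → Finset V) : Prop :=
  (∀ h ∈ H, h ∈ f h) ∧ ∀ v, ∀ h ∈ f v, h ∈ H ∧ f h = f v

open scoped Classical in
/-- The set of vertices of `H` that are connected to `v` in `G`. -/
noncomputable def label (H : Finset V) (G : SimpleGraph V) (v : V) : Finset V :=
  H.filter fun h => G.Reachable v h

theorem mem_label {H : Finset V} {G : SimpleGraph V} {v h : V} :
    h ∈ label H G v ↔ h ∈ H ∧ G.Reachable v h := by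
  simp [label]

theorem label_eq_of_reachable {H : Finset V} {G : SimpleGraph V} {u v : V}
    (h : G.Reachable u v) : label H G u = label H G v := by
  ext w
  simp only [mem_label]
  exact and_congr_right fun _ => ⟨fun h' => h.symm.trans h', fun h' => h.trans h'⟩

theorem isLabelling_label (H : Finset V) (G : SimpleGraph V) : IsLabelling H (label H G) :=
  ⟨fun _ h => mem_label.2 ⟨h, .rfl⟩, fun _ _ h =>
    ⟨(mem_label.1 h).1, (label_eq_of_reachable (mem_label.1 h).2).symm⟩⟩

/-- Vertices sharing a nonempty label are all connected to any element of it, and that element lies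
in their fibre. The label ∅ imposes no connectivity. -/
theorem label_eq_iff {H : Finset V} {f : V → Finset V} (hf : IsLabelling H f)
    (G : SimpleGraph V) :
    label H G = f ↔ ∃ h : ∀ u v, G.Adj u v → f u = f v,
      ∀ k, k ≠ ∅ → (fiberEquiv f ⟨G, h⟩ k).Preconnected := by
  constructor
  · rintro rfl
    have hadj : ∀ u v, G.Adj u v → label H G u = label H G v :=
      fun u v h => label_eq_of_reachable h.reachable
    refine ⟨hadj, ?_⟩
    rintro k hk ⟨u, hu⟩ ⟨v, hv⟩
    obtain ⟨w, hw⟩ := Finset.nonempty_iff_ne_empty.2 hk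
    have h1 : G.Reachable u w := (mem_label.1 (hu ▸ hw)).2
    have h2 : G.Reachable v w := (mem_label.1 (hv ▸ hw)).2
    exact (h1.trans h2.symm).comap_of_fiber hadj hu hv
  · rintro ⟨hadj, hpre⟩
    ext v w
    rw [mem_label]
    constructor
    · rintro ⟨hw, h⟩
      rw [eq_of_reachable hadj h]
      exact hf.1 w hw
    · intro hw
      obtain ⟨h1, h2⟩ := hf.2 v w hw
      refine ⟨h1, ?_⟩
      have := hpre (f v) (Finset.ne_empty_of_mem hw) ⟨v, rfl⟩ ⟨w, h2⟩
      exact this.map (⟨Subtype.val, fun h => h⟩ : fiberEquiv f ⟨G, hadj⟩ (f v) →g G)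

variable [DecidableEq V]

/-- The number of graphs on `n` vertices with the common label `k`. -/
noncomputable def fiberCount (k : Finset V) (n : ℕ) : ℕ :=
  if k = ∅ then Nat.card (SimpleGraph (Fin n)) else preconnectedCount n

theorem fiberCount_pos (k : Finset V) (n : ℕ) : 0 < fiberCount k n := by
  unfold fiberCount
  split_ifs
  · exact Nat.card_pos
  · exact preconnectedCount_pos n

theorem fiberCount_sq_le (k : Finset V) (n : ℕ) :
    fiberCount k (n + 1) ^ 2 ≤ fiberCount k (n + 2) * fiberCount k n := by
  unfold fiberCount
  split_ifs
  · exact card_simpleGraph_fin_sq_le n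
  · exact preconnectedCount_sq_le n

/-- The function `g` with the values at `x` and `y` replaced by `i` and `j`. -/
def updateTwo (g : V → Finset V) (x y : V) (i j : Finset V) : V → Finset V :=
  Function.update (Function.update g x i) y j

theorem updateTwo_eq_and_iff {x y : V} (hxy : x ≠ y) {g f : V → Finset V} {i j : Finset V} :
    updateTwo f x y ∅ ∅ = g ∧ f x = i ∧ f y = j ↔
      (g x = ∅ ∧ g y = ∅) ∧ f = updateTwo g x y i j := by
  constructor
  · rintro ⟨rfl, rfl, rfl⟩
    refine ⟨⟨by simp [updateTwo, hxy], by simp [updateTwo]⟩, ?_⟩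
    funext v
    by_cases h1 : v = y
    · simp [updateTwo, h1]
    · by_cases h2 : v = x
      · simp [updateTwo, h2, hxy]
      · simp [updateTwo, h1, h2]
  · rintro ⟨⟨h1, h2⟩, rfl⟩
    refine ⟨?_, by simp [updateTwo, hxy], by simp [updateTwo]⟩
    funext v
    by_cases h3 : v = y
    · simp [updateTwo, h3, h2]
    · by_cases h4 : v = x
      · simp [updateTwo, h4, hxy, h1]
      · simp [updateTwo, h3, h4]

/-- As x and y are outside `H`, no label contains them, so admissibility splits into separate
conditions on `g`, `i` and `j`. This makes the joint law factor. -/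
theorem isLabelling_updateTwo {H : Finset V} {g : V → Finset V} {x y : V} (hxy : x ≠ y)
    (hx : x ∉ H) (hy : y ∉ H) (i j : Finset V) :
    IsLabelling H (updateTwo g x y i j) ↔
      ((∀ h ∈ H, h ∈ g h) ∧ ∀ v, v ≠ x → v ≠ y → ∀ h ∈ g v, h ∈ H ∧ g h = g v) ∧
        (∀ h ∈ i, h ∈ H ∧ g h = i) ∧ ∀ h ∈ j, h ∈ H ∧ g h = j := by
  have hH : ∀ h ∈ H, updateTwo g x y i j h = g h := by
    intro h hh
    have h1 : h ≠ x := fun e => hx (e ▸ hh)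
    have h2 : h ≠ y := fun e => hy (e ▸ hh)
    simp [updateTwo, h1, h2]
  have hvx : updateTwo g x y i j x = i := by simp [updateTwo, hxy]
  have hvy : updateTwo g x y i j y = j := by simp [updateTwo]
  have hv : ∀ v, v ≠ x → v ≠ y → updateTwo g x y i j v = g v := by
    intro v h1 h2; simp [updateTwo, h1, h2]
  constructor
  · rintro ⟨h1, h2⟩
    refine ⟨⟨fun h hh => hH h hh ▸ h1 h hh, fun v hx hy h hh => ?_⟩, fun h hh => ?_, fun h hh => ?_⟩
    · have := h2 v h (by rwa [hv v hx hy])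
      rwa [hH h this.1, hv v hx hy] at this
    · have := h2 x h (by rwa [hvx])
      rwa [hH h this.1, hvx] at this
    · have := h2 y h (by rwa [hvy])
      rwa [hH h this.1, hvy] at this
  · rintro ⟨⟨h1, h2⟩, h3, h4⟩
    refine ⟨fun h hh => (hH h hh).symm ▸ h1 h hh, fun v h hh => ?_⟩
    suffices h ∈ H ∧ g h = updateTwo g x y i j v from ⟨this.1, (hH h this.1).trans this.2⟩
    by_cases hvx' : v = x
    · subst hvx'; rw [hvx] at hh ⊢; exact h3 h hh
    by_cases hvy' : v = y
    · subst hvy'; rw [hvy] at hh ⊢; exact h4 h hh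
    · rw [hv v hvx' hvy'] at hh ⊢; exact h2 v hvx' hvy' h hh

variable [Fintype V]

theorem card_label_eq {H : Finset V} {f : V → Finset V} (hf : IsLabelling H f) :
    Nat.card {G : SimpleGraph V // label H G = f} =
      ∏ k, fiberCount k (Nat.card {v // f v = k}) := by
  have e : {G : SimpleGraph V // label H G = f} ≃
      ∀ k, {G : SimpleGraph {v // f v = k} // k ≠ ∅ → G.Preconnected} :=
    ((Equiv.subtypeEquivRight (label_eq_iff hf)).trans
      (Equiv.subtypeSubtypeEquivSubtypeExists _
        fun G => ∀ k, k ≠ ∅ → (fiberEquiv f G k).Preconnected).symm).trans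
      (((fiberEquiv f).subtypeEquiv fun G => Iff.rfl).trans
        (Equiv.subtypePiEquivPi (p := fun k (G : SimpleGraph {v // f v = k}) =>
          k ≠ ∅ → G.Preconnected)))
  rw [Nat.card_congr e, Nat.card_pi]
  refine Finset.prod_congr rfl fun k _ => ?_
  by_cases hk : k = ∅
  · rw [fiberCount, if_pos hk, ← card_simpleGraph]
    exact Nat.card_congr (Equiv.subtypeUnivEquiv fun _ h => absurd hk h)
  · simp only [fiberCount, hk, ne_eq, not_false_eq_true, forall_true_left, if_false]
    exact card_preconnected _

theorem card_fiber_updateTwo (g : V → Finset V) {x y : V} (hxy : x ≠ y) (i j k : Finset V) :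
    Nat.card {v // updateTwo g x y i j v = k} =
      ((Finset.univ.erase x).erase y |>.filter fun v => g v = k).card +
        ((if i = k then 1 else 0) + if j = k then 1 else 0) := by
  rw [Nat.card_eq_fintype_card, Fintype.card_subtype, Finset.card_filter, Finset.card_filter,
    ← Finset.add_sum_erase _ _ (Finset.mem_univ x),
    ← Finset.add_sum_erase _ _ (Finset.mem_erase.2 ⟨hxy.symm, Finset.mem_univ y⟩)]
  have : ∀ v ∈ (Finset.univ.erase x).erase y, (if updateTwo g x y i j v = k then 1 else 0) =
      if g v = k then 1 else 0 := by
    intro v hv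
    simp only [Finset.mem_erase, Finset.mem_univ, and_true] at hv
    simp [updateTwo, hv.1, hv.2]
  rw [Finset.sum_congr rfl this]
  simp [updateTwo, hxy]
  ring

/-- Each added vertex changes one factor by a ratio; only when both land in the same fibre is there
a correction, nonnegative under log-convexity. -/
theorem prod_eq_mul_add {I : Type*} [Fintype I] [DecidableEq I] (w : I → ℕ → ℝ)
    (hw : ∀ k n, 0 < w k n) (i j : I) :
    ∏ k, w k ((if i = k then 1 else 0) + if j = k then 1 else 0) =
      (∏ k, w k 0) * (w i 1 / w i 0 * (w j 1 / w j 0) +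
        if i = j then w i 2 / w i 0 - (w i 1 / w i 0) ^ 2 else 0) := by
  have h0 : ∀ k, w k 0 ≠ 0 := fun k => (hw k 0).ne'
  by_cases hij : i = j
  · subst hij
    have : ∀ k, w k ((if i = k then 1 else 0) + if i = k then 1 else 0) =
        w k 0 * if i = k then w k 2 / w k 0 else 1 := by
      intro k
      split_ifs
      · field_simp [h0 k]
      · simp
    simp_rw [this, Finset.prod_mul_distrib, Finset.prod_ite_eq]
    simp
    left; ring
  · have : ∀ k, w k ((if i = k then 1 else 0) + if j = k then 1 else 0) =
        w k 0 * ((if i = k then w k 1 / w k 0 else 1) * if j = k then w k 1 / w k 0 else 1) := by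
      intro k
      by_cases h1 : i = k
      · have h2 : j ≠ k := fun h => hij (h1.trans h.symm)
        simp only [h1, h2, if_true, if_false]
        field_simp [h0 k]
      · by_cases h2 : j = k
        · simp only [h1, h2, if_true, if_false]
          field_simp [h0 k]
        · simp [h1, h2]
    simp_rw [this, Finset.prod_mul_distrib, Finset.prod_ite_eq]
    simp [hij]

/-- Given the labels of all other vertices, the joint law of the labels of two vertices is
proportional to a product law plus a nonnegative diagonal term. -/
theorem exists_card_label_eq_mul_add {H : Finset V} (g : V → Finset V) {x y : V} (hxy : x ≠ y)
    (hx : x ∉ H) (hy : y ∉ H) :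
    ∃ P : ℝ, ∃ r d : Finset V → ℝ, (∀ i, 0 ≤ d i) ∧ ∀ i j,
      (Nat.card {G : SimpleGraph V // label H G = updateTwo g x y i j} : ℝ) =
        P * (r i * r j + if i = j then d i else 0) := by
  classical
  set n : Finset V → ℕ := fun k => ((Finset.univ.erase x).erase y |>.filter fun v => g v = k).card
  set w : Finset V → ℕ → ℝ := fun k m => fiberCount k (n k + m)
  have hw : ∀ k m, 0 < w k m := fun k m => Nat.cast_pos.2 (fiberCount_pos k _)
  set B : Prop := (∀ h ∈ H, h ∈ g h) ∧ ∀ v, v ≠ x → v ≠ y → ∀ h ∈ g v, h ∈ H ∧ g h = g v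
  set a : Finset V → Prop := fun i => ∀ h ∈ i, h ∈ H ∧ g h = i
  refine ⟨if B then ∏ k, w k 0 else 0, fun i => if a i then w i 1 / w i 0 else 0,
    fun i => if a i then w i 2 / w i 0 - (w i 1 / w i 0) ^ 2 else 0, ?_, ?_⟩
  · intro i
    dsimp only
    split_ifs
    · have h : w i 1 ^ 2 ≤ w i 2 * w i 0 := by
        simp only [w]
        exact_mod_cast fiberCount_sq_le i (n i)
      have h0 := hw i 0
      rw [sub_nonneg, div_pow, div_le_div_iff₀ (by positivity) h0]
      nlinarith
    · exact le_rfl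
  · intro i j
    have key := isLabelling_updateTwo (g := g) hxy hx hy i j
    by_cases hl : IsLabelling H (updateTwo g x y i j)
    · obtain ⟨h1, h2, h3⟩ := key.1 hl
      have h2 : a i := h2
      have h3 : a j := h3
      rw [card_label_eq hl]
      simp only [card_fiber_updateTwo g hxy]
      push_cast
      rw [if_pos h1]
      simp only [h2, h3, if_true]
      exact prod_eq_mul_add w hw i j
    · have : IsEmpty {G : SimpleGraph V // label H G = updateTwo g x y i j} :=
        ⟨fun G => hl (G.2 ▸ isLabelling_label H G.1)⟩
      rw [Nat.card_of_isEmpty, Nat.cast_zero]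
      by_cases hB : B
      · by_cases hi : a i
        · have hj : ¬ a j := fun hj => hl (key.2 ⟨hB, hi, hj⟩)
          -- The conditions on the two labels are the same predicate, so the diagonal term is absent
          -- here.
          have hij : i ≠ j := fun e => hj (e ▸ hi)
          simp [hj, hij]
        · simp [hi]
      · simp [hB]

end SimpleGraph

/-! ### Positive correlation from a product law plus a diagonal. -/

section Correlation

variable {I : Type*} [DecidableEq I]

theorem sum_sum_mul_add_diagonal (P : ℝ) (r d : I → ℝ) (L S : Finset I) :
    ∑ i ∈ L, ∑ j ∈ S, P * (r i * r j + if i = j then d i else 0) =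
      P * ((∑ i ∈ L, r i) * (∑ j ∈ S, r j) + ∑ i ∈ L ∩ S, d i) := by
  simp_rw [← Finset.mul_sum, Finset.sum_add_distrib, Finset.sum_mul_sum, Finset.sum_ite_eq,
    Finset.sum_ite_mem]

variable {Γ : Type*} [Fintype Γ]

theorem card_filter_eq_sum_sum (q : Γ → Prop) [DecidablePred q] (X Y : Γ → I) (L S : Finset I) :
    (Finset.univ.filter fun G => q G ∧ X G ∈ L ∧ Y G ∈ S).card =
      ∑ i ∈ L, ∑ j ∈ S, (Finset.univ.filter fun G => q G ∧ X G = i ∧ Y G = j).card := by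
  rw [← Finset.sum_product', Finset.card_eq_sum_card_fiberwise (f := fun G => (X G, Y G))
    (t := L ×ˢ S)]
  · refine Finset.sum_congr rfl fun p hp => congrArg _ ?_
    obtain ⟨h1, h2⟩ := Finset.mem_product.1 hp
    ext G
    simp only [Finset.mem_filter, Finset.mem_univ, true_and, Prod.ext_iff]
    constructor
    · rintro ⟨⟨h, -, -⟩, h3, h4⟩; exact ⟨h, h3, h4⟩
    · rintro ⟨h, h3, h4⟩; exact ⟨⟨h, h3 ▸ h1, h4 ▸ h2⟩, h3, h4⟩
  · intro G hG
    simp_all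

/-- The joint law of `X` and `Y` on the event `q` is a multiple of the square of a measure plus a
nonnegative diagonal term. -/
def IsProductPlusDiagonal (q : Γ → Prop) [DecidablePred q] (X Y : Γ → I) : Prop :=
  ∃ P : ℝ, ∃ r d : I → ℝ, (∀ i, 0 ≤ d i) ∧ ∀ i j,
    ((Finset.univ.filter fun G => q G ∧ X G = i ∧ Y G = j).card : ℝ) =
      P * (r i * r j + if i = j then d i else 0)

variable [Fintype I]

theorem sq_sum_le_of_eq_mul_add_diagonal {P : ℝ} {r d : I → ℝ} (hd : ∀ i, 0 ≤ d i)
    (L : Finset I) :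
    (∑ i ∈ L, ∑ j, P * (r i * r j + if i = j then d i else 0)) ^ 2 ≤
      (∑ i ∈ L, ∑ j ∈ L, P * (r i * r j + if i = j then d i else 0)) *
        ∑ i, ∑ j, P * (r i * r j + if i = j then d i else 0) := by
  simp_rw [sum_sum_mul_add_diagonal, Finset.inter_self, Finset.inter_univ]
  have h1 : 0 ≤ ∑ i ∈ L, d i := Finset.sum_nonneg fun i _ => hd i
  have h2 : ∑ i ∈ L, d i ≤ ∑ i, d i :=
    Finset.sum_le_sum_of_subset_of_nonneg (Finset.subset_univ L) fun i _ _ => hd i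
  set R := ∑ i ∈ L, r i
  set T := ∑ i, r i
  set D := ∑ i ∈ L, d i
  set E := ∑ i, d i
  -- This is exactly the right side minus the left side; the sign of `P` is irrelevant.
  have h3 : 0 ≤ P ^ 2 * (D * (T - R) ^ 2 + (E - D) * (R ^ 2 + D)) := by
    have := sub_nonneg.2 h2
    positivity
  nlinarith

variable {q : Γ → Prop} [DecidablePred q] {X Y : Γ → I}

theorem IsProductPlusDiagonal.card_left_eq_card_right (h : IsProductPlusDiagonal q X Y)
    (L : Finset I) :
    (Finset.univ.filter fun G => q G ∧ X G ∈ L).card =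
      (Finset.univ.filter fun G => q G ∧ Y G ∈ L).card := by
  obtain ⟨P, r, d, -, h⟩ := h
  have h1 := card_filter_eq_sum_sum q X Y L Finset.univ
  have h2 := card_filter_eq_sum_sum q X Y Finset.univ L
  simp only [Finset.mem_univ, and_true, true_and] at h1 h2
  rw [h1, h2, Finset.sum_comm, ← Nat.cast_inj (R := ℝ)]
  push_cast
  refine Finset.sum_congr rfl fun j _ => Finset.sum_congr rfl fun i _ => ?_
  rw [h, h]
  by_cases hij : i = j
  · subst hij; simp
  · simp [hij, Ne.symm hij, mul_comm]

theorem IsProductPlusDiagonal.card_sq_le (h : IsProductPlusDiagonal q X Y) (L : Finset I) :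
    (Finset.univ.filter fun G => q G ∧ X G ∈ L).card ^ 2 ≤
      (Finset.univ.filter fun G => q G ∧ X G ∈ L ∧ Y G ∈ L).card *
        (Finset.univ.filter fun G => q G).card := by
  obtain ⟨P, r, d, hd, h⟩ := h
  have h1 := card_filter_eq_sum_sum q X Y L Finset.univ
  have h2 := card_filter_eq_sum_sum q X Y L L
  have h3 := card_filter_eq_sum_sum q X Y Finset.univ Finset.univ
  simp only [Finset.mem_univ, and_true] at h1 h3
  rw [h1, h2, h3, ← Nat.cast_le (α := ℝ)]
  push_cast
  simp_rw [h]
  exact sq_sum_le_of_eq_mul_add_diagonal hd L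

end Correlation

/-! ### Comparing one copy with two independent copies. -/

section Comparison

variable {Γ R I Λ : Type*} [Fintype Γ] [Fintype R] [DecidableEq R]
  [Fintype Λ] [DecidableEq Λ]

theorem two_mul_le_add_of_sq_le {a a' b b' m m' : ℕ} (h : a ^ 2 ≤ b * m) (h' : a' ^ 2 ≤ b' * m') :
    2 * (a * a') ≤ b * m' + b' * m := by
  have h1 : (2 * (a * a')) ^ 2 ≤ (b * m' + b' * m) ^ 2 := by
    have h2 : (a * a') ^ 2 ≤ b * m * (b' * m') := by
      rw [mul_pow]; exact Nat.mul_le_mul h h'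
    have h3 := four_mul_le_sq_add (b * m') (b' * m)
    nlinarith
  exact (Nat.pow_le_pow_iff_left two_ne_zero).1 h1

theorem card_filter_pair_eq_sum (r : Γ → R) (κ : R → R → I → Λ) (bad : Λ) (X : Γ → I)
    (u : Γ × Γ → Λ → Prop) [∀ p l, Decidable (u p l)] :
    (Finset.univ.filter fun p : Γ × Γ =>
        κ (r p.1) (r p.2) (X p.1) ≠ bad ∧ u p (κ (r p.1) (r p.2) (X p.1))).card =
      ∑ g, ∑ g', ∑ l with l ≠ bad, (Finset.univ.filter fun p : Γ × Γ =>
        r p.1 = g ∧ r p.2 = g' ∧ κ g g' (X p.1) = l ∧ u p l).card := by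
  simp_rw [← Finset.sum_product']
  rw [Finset.card_eq_sum_card_fiberwise
    (f := fun p => (r p.1, r p.2, κ (r p.1) (r p.2) (X p.1)))
    (t := Finset.univ ×ˢ Finset.univ ×ˢ Finset.univ.filter fun l => l ≠ bad)]
  · refine Finset.sum_congr rfl ?_
    rintro ⟨g, g', l⟩ hp
    refine congrArg _ ?_
    simp only [Finset.mem_product, Finset.mem_filter, Finset.mem_univ, true_and] at hp
    ext p
    simp only [Finset.mem_filter, Finset.mem_univ, true_and, Prod.mk.injEq]
    constructor
    · rintro ⟨⟨h1, h2⟩, rfl, rfl, rfl⟩; exact ⟨rfl, rfl, rfl, h2⟩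
    · rintro ⟨rfl, rfl, rfl, h⟩; exact ⟨⟨hp, h⟩, rfl, rfl, rfl⟩
  · intro p hp
    simp_all

variable [Fintype I] [DecidableEq I]

/-- Two independent uniform copies of `(r, X, Y)` in which `X` and `Y` are positively correlated
given `r`: it is more likely that `X` and `Y` of the same copy fall in the same class than that `X`
of the first copy and `Y` of the second one do, if classes depend symmetrically on both `r`. -/
theorem card_same_class_le (r : Γ → R) (X Y : Γ → I) (κ : R → R → I → Λ)
    (hκ : ∀ g g', κ g g' = κ g' g) (bad : Λ)
    (h : ∀ g, IsProductPlusDiagonal (fun G => r G = g) X Y) :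
    (Finset.univ.filter fun p : Γ × Γ => κ (r p.1) (r p.2) (X p.1) ≠ bad ∧
        κ (r p.1) (r p.2) (Y p.2) = κ (r p.1) (r p.2) (X p.1)).card ≤
      (Finset.univ.filter fun p : Γ × Γ => κ (r p.1) (r p.2) (X p.1) ≠ bad ∧
        κ (r p.1) (r p.2) (Y p.1) = κ (r p.1) (r p.2) (X p.1)).card := by
  rw [card_filter_pair_eq_sum r κ bad X (fun p l => κ (r p.1) (r p.2) (Y p.2) = l),
    card_filter_pair_eq_sum r κ bad X (fun p l => κ (r p.1) (r p.2) (Y p.1) = l)]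
  set a : R → R → Λ → ℕ := fun g g' l =>
    (Finset.univ.filter fun G => r G = g ∧ X G ∈ Finset.univ.filter fun i => κ g g' i = l).card
  set b : R → R → Λ → ℕ := fun g g' l =>
    (Finset.univ.filter fun G => r G = g ∧ (X G ∈ Finset.univ.filter fun i => κ g g' i = l) ∧
      Y G ∈ Finset.univ.filter fun i => κ g g' i = l).card
  set m : R → ℕ := fun g => (Finset.univ.filter fun G => r G = g).card
  have e1 : ∀ g g' l, (Finset.univ.filter fun p : Γ × Γ => r p.1 = g ∧ r p.2 = g' ∧
      κ g g' (X p.1) = l ∧ κ (r p.1) (r p.2) (Y p.2) = l).card = a g g' l * a g' g l := by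
    intro g g' l
    simp only [a]
    rw [(h g').card_left_eq_card_right, ← Finset.card_product]
    refine congrArg _ ?_
    ext p
    simp only [Finset.mem_filter, Finset.mem_univ, true_and, Finset.mem_product, hκ g' g]
    constructor
    · rintro ⟨rfl, rfl, h1, h2⟩; exact ⟨⟨rfl, h1⟩, rfl, h2⟩
    · rintro ⟨⟨rfl, h1⟩, rfl, h2⟩; exact ⟨rfl, rfl, h1, h2⟩
  have e2 : ∀ g g' l, (Finset.univ.filter fun p : Γ × Γ => r p.1 = g ∧ r p.2 = g' ∧
      κ g g' (X p.1) = l ∧ κ (r p.1) (r p.2) (Y p.1) = l).card = b g g' l * m g' := by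
    intro g g' l
    simp only [b, m]
    rw [← Finset.card_product]
    refine congrArg _ ?_
    ext p
    simp only [Finset.mem_filter, Finset.mem_univ, true_and, Finset.mem_product]
    constructor
    · rintro ⟨rfl, rfl, h1, h2⟩; exact ⟨⟨rfl, h1, h2⟩, rfl⟩
    · rintro ⟨⟨rfl, h1, h2⟩, rfl⟩; exact ⟨rfl, rfl, h1, h2⟩
  simp_rw [e1, e2]
  have key : ∀ g g' l, 2 * (a g g' l * a g' g l) ≤ b g g' l * m g' + b g' g l * m g :=
    fun g g' l => two_mul_le_add_of_sq_le ((h g).card_sq_le _) ((h g').card_sq_le _)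
  have sum_key : 2 * ∑ g, ∑ g', ∑ l with l ≠ bad, a g g' l * a g' g l ≤
      (∑ g, ∑ g', ∑ l with l ≠ bad, b g g' l * m g') +
        ∑ g, ∑ g', ∑ l with l ≠ bad, b g' g l * m g := by
    simp_rw [Finset.mul_sum, ← Finset.sum_add_distrib]
    exact Finset.sum_le_sum fun g _ => Finset.sum_le_sum fun g' _ =>
      Finset.sum_le_sum fun l _ => key g g' l
  -- Exchanging the copies identifies the two sums on the right, cancelling the factor 2.
  rw [Finset.sum_comm (f := fun g g' => ∑ l with l ≠ bad, b g' g l * m g)] at sum_key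
  omega

end Comparison

/-! ### Connections between two levels with fixed vertical edges. -/

namespace SimpleGraph

variable {V : Type*}

/-- The graph on two levels with the edges of `G₀` on level `0`, those of `G₁` on level `1`, and a
vertical edge at every vertex of `H`. -/
def layered (H : Finset V) (G₀ G₁ : SimpleGraph V) : SimpleGraph (V × Fin 2) where
  Adj u v := (u.2 = v.2 ∧ (![G₀, G₁] u.2).Adj u.1 v.1) ∨ (u.1 = v.1 ∧ u.1 ∈ H ∧ u.2 ≠ v.2)
  symm := ⟨by
    rintro ⟨u, i⟩ ⟨v, j⟩ (⟨h, h'⟩ | ⟨h, h', h''⟩)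
    · dsimp only at h h'
      subst h
      exact Or.inl ⟨rfl, h'.symm⟩
    · dsimp only at h h' h''
      subst h
      exact Or.inr ⟨rfl, h', h''.symm⟩⟩
  loopless := ⟨by rintro ⟨u, i⟩; simp⟩

variable {H : Finset V} {G₀ G₁ : SimpleGraph V}

theorem layered_reachable_level (i : Fin 2) {u v : V} (h : (![G₀, G₁] i).Reachable u v) :
    (layered H G₀ G₁).Reachable (u, i) (v, i) :=
  h.map (⟨fun w => (w, i), fun h => Or.inl ⟨rfl, h⟩⟩ : ![G₀, G₁] i →g layered H G₀ G₁)

theorem layered_reachable_vertical {h : V} (hh : h ∈ H) (i j : Fin 2) :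
    (layered H G₀ G₁).Reachable (h, i) (h, j) := by
  by_cases hij : i = j
  · rw [hij]
  · exact Adj.reachable (Or.inr ⟨rfl, hh, hij⟩)

theorem layered_reachable_swap {u v : V} {i j : Fin 2}
    (h : (layered H G₀ G₁).Reachable (u, i) (v, j)) :
    (layered H G₁ G₀).Reachable (u, i.rev) (v, j.rev) := by
  refine h.map (⟨fun w => (w.1, w.2.rev), ?_⟩ : layered H G₀ G₁ →g layered H G₁ G₀)
  rintro ⟨u, i⟩ ⟨v, j⟩ (⟨h, h'⟩ | ⟨h, h', h''⟩)
  · dsimp only at h h'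
    subst h
    refine Or.inl ⟨rfl, ?_⟩
    fin_cases i <;> exact h'
  · exact Or.inr ⟨h, h', fun e => h'' (Fin.rev_injective e)⟩

/-- A path to level 1 leaves the level-0 component of `u` only through a vertical edge, whose foot
lies in `H`. -/
theorem label_nonempty_of_layered_reachable {u v : V}
    (huv : (layered H G₀ G₁).Reachable (u, 0) (v, 1)) : (label H G₀ u).Nonempty := by
  by_contra hu
  obtain ⟨p⟩ := huv
  obtain ⟨d, -, ⟨h1, h2⟩, h3⟩ := p.exists_boundary_dart {w | w.2 = 0 ∧ G₀.Reachable u w.1}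
    ⟨rfl, .rfl⟩ (by simp)
  rcases d.adj with ⟨h, h'⟩ | ⟨-, h', -⟩
  · rw [h1] at h h'
    exact h3 ⟨h.symm, h2.trans (Adj.reachable h')⟩
  · exact hu ⟨_, mem_label.2 ⟨h', h2⟩⟩

theorem layered_reachable_of_reflTransGen {g g' : V → Finset V}
    (hg : ∀ h ∈ H, g h = label H G₀ h) (hg' : ∀ h ∈ H, g' h = label H G₁ h) {a b : V} (ha : a ∈ H)
    (hab : Relation.ReflTransGen (fun a b => b ∈ g a ∨ b ∈ g' a) a b) :
    b ∈ H ∧ (layered H G₀ G₁).Reachable (a, 0) (b, 0) := by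
  induction hab with
  | refl => exact ⟨ha, .rfl⟩
  | @tail b c _ hbc ih =>
    obtain ⟨hb, hr⟩ := ih
    rw [hg b hb, hg' b hb, mem_label, mem_label] at hbc
    rcases hbc with ⟨hc, h⟩ | ⟨hc, h⟩
    · exact ⟨hc, hr.trans (layered_reachable_level 0 h)⟩
    · exact ⟨hc, ((hr.trans (layered_reachable_vertical hb 0 1)).trans
        (layered_reachable_level 1 h)).trans (layered_reachable_vertical hc 1 0)⟩

theorem updateTwo_label_apply [DecidableEq V] {x y : V} (hx : x ∉ H) (hy : y ∉ H) (G : SimpleGraph V)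
    (i j : Finset V) {h : V} (hh : h ∈ H) : updateTwo (label H G) x y i j h = label H G h := by
  have h1 : h ≠ x := fun e => hx (e ▸ hh)
  have h2 : h ≠ y := fun e => hy (e ▸ hh)
  simp [updateTwo, h1, h2]

variable [Fintype V]

open scoped Classical in
/-- The set of vertices that are reached from `i` by steps from `a` to elements of `g a` or
`g' a`. -/
noncomputable def labelClosure (g g' : V → Finset V) (i : Finset V) : Finset V :=
  Finset.univ.filter fun b =>
    ∃ a ∈ i, Relation.ReflTransGen (fun a b => b ∈ g a ∨ b ∈ g' a) a b

theorem mem_labelClosure {g g' : V → Finset V} {i : Finset V} {b : V} :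
    b ∈ labelClosure g g' i ↔
      ∃ a ∈ i, Relation.ReflTransGen (fun a b => b ∈ g a ∨ b ∈ g' a) a b := by
  simp [labelClosure]

theorem labelClosure_comm (g g' : V → Finset V) : labelClosure g g' = labelClosure g' g := by
  funext i
  ext b
  simp only [mem_labelClosure, or_comm]

theorem mem_labelClosure_label {G : SimpleGraph V} {g g' : V → Finset V} {h : V} (hh : h ∈ H)
    (hG : g h = label H G h ∨ g' h = label H G h) {b : V} :
    b ∈ labelClosure g g' (label H G h) ↔
      Relation.ReflTransGen (fun a b => b ∈ g a ∨ b ∈ g' a) h b := by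
  rw [mem_labelClosure]
  constructor
  · rintro ⟨a, ha, hab⟩
    exact .head (hG.imp (fun e => e ▸ ha) (fun e => e ▸ ha)) hab
  · exact fun hb => ⟨h, mem_label.2 ⟨hh, .rfl⟩, hb⟩

/-- Horizontal edges preserve the label on their level; at the foot h of a vertical edge both labels
have as closure everything reached from h. -/
theorem labelClosure_label_eq {g g' : V → Finset V} (hg : ∀ h ∈ H, g h = label H G₀ h)
    (hg' : ∀ h ∈ H, g' h = label H G₁ h) {u v : V × Fin 2}
    (huv : (layered H G₀ G₁).Reachable u v) :
    labelClosure g g' (label H (![G₀, G₁] u.2) u.1) =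
      labelClosure g g' (label H (![G₀, G₁] v.2) v.1) := by
  have hlevel : ∀ h ∈ H, ∀ i, g h = label H (![G₀, G₁] i) h ∨ g' h = label H (![G₀, G₁] i) h :=
    fun h hh => Fin.forall_fin_two.2 ⟨Or.inl (hg h hh), Or.inr (hg' h hh)⟩
  obtain ⟨p⟩ := huv
  induction p with
  | nil => rfl
  | cons h p ih =>
    refine Eq.trans ?_ ih
    rcases h with ⟨h, h'⟩ | ⟨h, h', -⟩
    · rw [← h, label_eq_of_reachable h'.reachable]
    · rw [← h]
      ext b
      rw [mem_labelClosure_label h' (hlevel _ h' _), mem_labelClosure_label h' (hlevel _ h' _)]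

theorem labelClosure_nonempty {g g' : V → Finset V} {i : Finset V} (hi : i.Nonempty) :
    labelClosure g g' i ≠ ∅ := by
  obtain ⟨a, ha⟩ := hi
  exact Finset.ne_empty_of_mem (mem_labelClosure.2 ⟨a, ha, .refl⟩)

theorem layered_reachable_of_labelClosure_eq {g g' : V → Finset V}
    (hg : ∀ h ∈ H, g h = label H G₀ h) (hg' : ∀ h ∈ H, g' h = label H G₁ h) {u v : V}
    (hne : labelClosure g g' (label H G₀ u) ≠ ∅)
    (heq : labelClosure g g' (label H G₀ v) = labelClosure g g' (label H G₀ u)) :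
    (layered H G₀ G₁).Reachable (u, 0) (v, 0) := by
  have key : ∀ w b, b ∈ labelClosure g g' (label H G₀ w) →
      (layered H G₀ G₁).Reachable (w, 0) (b, 0) := by
    intro w b hb
    obtain ⟨a, ha, hab⟩ := mem_labelClosure.1 hb
    rw [mem_label] at ha
    exact (layered_reachable_level 0 ha.2).trans
      (layered_reachable_of_reflTransGen hg hg' ha.1 hab).2
  obtain ⟨b, hb⟩ := Finset.nonempty_iff_ne_empty.2 hne
  exact (key u b hb).trans (key v b (heq ▸ hb)).symm

variable [DecidableEq V]

theorem isProductPlusDiagonal_label {x y : V} (hxy : x ≠ y) (hx : x ∉ H) (hy : y ∉ H)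
    (g : V → Finset V) :
    IsProductPlusDiagonal (fun G : SimpleGraph V => updateTwo (label H G) x y ∅ ∅ = g)
      (fun G => label H G x) fun G => label H G y := by
  classical
  by_cases hg : g x = ∅ ∧ g y = ∅
  · obtain ⟨P, r, d, hd, h⟩ := exists_card_label_eq_mul_add g hxy hx hy
    refine ⟨P, r, d, hd, fun i j => ?_⟩
    rw [← h, Nat.card_eq_fintype_card, Fintype.card_subtype]
    simp_rw [updateTwo_eq_and_iff hxy, hg, true_and]
  -- The conditioning data has blanks at x and y, so such a `g` never occurs.
  · refine ⟨0, 0, 0, fun _ => le_rfl, fun i j => ?_⟩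
    simp_rw [updateTwo_eq_and_iff hxy, hg, false_and]
    simp

open scoped Classical in
theorem card_layered_reachable_le (H : Finset V) (x y : V) :
    (Finset.univ.filter fun p : SimpleGraph V × SimpleGraph V =>
        (layered H p.1 p.2).Reachable (x, 0) (y, 1)).card ≤
      (Finset.univ.filter fun p : SimpleGraph V × SimpleGraph V =>
        (layered H p.1 p.2).Reachable (x, 0) (y, 0)).card := by
  by_cases hxy : x = y
  · subst hxy
    exact Finset.card_le_card fun p _ => by simp
  by_cases hx : x ∈ H
  -- Exchanging the levels joins (x,1) to (y,0), and the vertical edge at x is open.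
  · refine Finset.card_le_card_of_injOn Prod.swap (fun p hp => ?_) Prod.swap_injective.injOn
    simp only [Finset.coe_filter, Finset.mem_univ, true_and, Set.mem_ofPred_eq] at hp ⊢
    exact (layered_reachable_vertical hx 0 1).trans (layered_reachable_swap hp)
  by_cases hy : y ∈ H
  · refine Finset.card_le_card fun p hp => ?_
    simp only [Finset.mem_filter, Finset.mem_univ, true_and] at hp ⊢
    exact hp.trans (layered_reachable_vertical hy 1 0)
  -- The empty closure is the excluded class: two empty labels agree without giving a connection.
  have h := card_same_class_le (fun G : SimpleGraph V => updateTwo (label H G) x y ∅ ∅)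
    (fun G => label H G x) (fun G => label H G y) labelClosure labelClosure_comm ∅
    (fun g => by convert isProductPlusDiagonal_label hxy hx hy g)
  refine (Finset.card_le_card fun p hp => ?_).trans
    (h.trans (Finset.card_le_card fun p hp => ?_))
  · simp only [Finset.mem_filter, Finset.mem_univ, true_and] at hp ⊢
    exact ⟨labelClosure_nonempty (label_nonempty_of_layered_reachable hp),
      (labelClosure_label_eq (fun _ => updateTwo_label_apply hx hy _ _ _)
        (fun _ => updateTwo_label_apply hx hy _ _ _) hp).symm⟩
  · simp only [Finset.mem_filter, Finset.mem_univ, true_and] at hp ⊢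
    exact layered_reachable_of_labelClosure_eq (fun _ => updateTwo_label_apply hx hy _ _ _)
        (fun _ => updateTwo_label_apply hx hy _ _ _) hp.1 hp.2

end SimpleGraph

open SimpleGraph

/-! ### Configurations as triples of vertical edges, lower graph and upper graph. -/

section Configurations

variable {V : Type*}

theorem openSubgraph_adj {G : SimpleGraph V} {ω : BondConfig G} {u v : V} :
    (openSubgraph G ω).Adj u v ↔ ∃ h : s(u, v) ∈ G.edgeSet, ω ⟨s(u, v), h⟩ = true := by
  rw [openSubgraph, fromEdgeSet_adj, Set.mem_ofPred_eq]
  exact and_iff_left_of_imp fun ⟨h, _⟩ => G.ne_of_adj h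

theorem openSubgraph_injective (G : SimpleGraph V) : Function.Injective (openSubgraph G) := by
  intro ω ω' h
  funext ⟨e, he⟩
  induction e with
  | _ u v =>
    have : (openSubgraph G ω).Adj u v ↔ (openSubgraph G ω').Adj u v := by rw [h]
    simp only [openSubgraph_adj, he, exists_true_left] at this
    exact Bool.eq_iff_iff.2 this

open scoped Classical in
/-- The configuration in which the edges of `B` are open. -/
noncomputable def configOfGraph (G B : SimpleGraph V) : BondConfig G :=
  fun e => decide (e.1 ∈ B.edgeSet)

theorem openSubgraph_configOfGraph {G B : SimpleGraph V} (h : B ≤ G) :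
    openSubgraph G (configOfGraph G B) = B := by
  ext u v
  simp only [openSubgraph_adj, configOfGraph, decide_eq_true_eq, mem_edgeSet, exists_prop]
  exact and_iff_right_of_imp fun h' => h h'

theorem layered_le_bunkbed (H : Finset V) (G₀ G₁ : SimpleGraph V) :
    layered H G₀ G₁ ≤ bunkbed (completeGraph V) := by
  rintro u v (⟨h, h'⟩ | ⟨h, -, h'⟩)
  · exact Or.inl ⟨h'.ne, h⟩
  · exact Or.inr ⟨h, h'⟩

/-- The bond configuration on the bunkbed graph of the complete graph with open vertical edges at
`H` and open horizontal edges `G₀` and `G₁`. -/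
noncomputable def layeredConfig (t : Finset V × SimpleGraph V × SimpleGraph V) :
    BondConfig (bunkbed (completeGraph V)) :=
  configOfGraph _ (layered t.1 t.2.1 t.2.2)

theorem openSubgraph_layeredConfig (t : Finset V × SimpleGraph V × SimpleGraph V) :
    openSubgraph _ (layeredConfig t) = layered t.1 t.2.1 t.2.2 :=
  openSubgraph_configOfGraph (layered_le_bunkbed _ _ _)

theorem layeredConfig_bijective [Fintype V] : Function.Bijective (layeredConfig (V := V)) := by
  classical
  constructor
  · rintro ⟨H, G₀, G₁⟩ ⟨H', G₀', G₁'⟩ h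
    have h' := congrArg (openSubgraph _) h
    simp only [openSubgraph_layeredConfig] at h'
    have key : ∀ u v, (layered H G₀ G₁).Adj u v ↔ (layered H' G₀' G₁').Adj u v := by simp [h']
    refine Prod.ext ?_ (Prod.ext ?_ ?_)
    · ext v
      simpa [layered] using key (v, 0) (v, 1)
    · ext u v
      simpa [layered] using key (u, 0) (v, 0)
    · ext u v
      simpa [layered] using key (u, 1) (v, 1)
  · intro ω
    set B := openSubgraph _ ω with hB
    have hle : B ≤ bunkbed (completeGraph V) := fun u v h => (openSubgraph_adj.1 h).1
    refine ⟨(Finset.univ.filter fun v => B.Adj (v, 0) (v, 1), B.comap (·, 0), B.comap (·, 1)), ?_⟩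
    apply openSubgraph_injective
    rw [openSubgraph_layeredConfig, ← hB]
    ext ⟨u, i⟩ ⟨v, j⟩
    constructor
    · rintro (⟨h, h'⟩ | ⟨h, h', h''⟩)
      · dsimp only at h h'
        subst h
        fin_cases i <;> exact h'
      · dsimp only at h h' h''
        subst h
        have h' := (Finset.mem_filter.1 h').2
        fin_cases i <;> fin_cases j
        · exact absurd rfl h''
        · exact h'
        · exact h'.symm
        · exact absurd rfl h''
    · intro h
      rcases hle h with ⟨-, h'⟩ | ⟨h', h''⟩
      · dsimp only at h'
        subst h'
        refine Or.inl ⟨rfl, ?_⟩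
        fin_cases i <;> exact h
      · dsimp only at h' h''
        subst h'
        refine Or.inr ⟨rfl, Finset.mem_filter.2 ⟨Finset.mem_univ _, ?_⟩, h''⟩
        fin_cases i <;> fin_cases j
        · exact absurd rfl h''
        · exact h
        · exact h.symm
        · exact absurd rfl h''

open scoped Classical in
theorem ncard_connectionEvent [Fintype V] (u v : V × Fin 2) :
    (connectionEvent (bunkbed (completeGraph V)) u v).ncard =
      ∑ H : Finset V, (Finset.univ.filter fun p : SimpleGraph V × SimpleGraph V =>
        (layered H p.1 p.2).Reachable u v).card := by
  have e : connectionEvent (bunkbed (completeGraph V)) u v =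
      layeredConfig '' ((Finset.univ.filter fun t : Finset V × SimpleGraph V × SimpleGraph V =>
        (layered t.1 t.2.1 t.2.2).Reachable u v : Finset _) : Set _) := by
    ext ω
    obtain ⟨t, rfl⟩ := layeredConfig_bijective.surjective ω
    rw [layeredConfig_bijective.injective.mem_set_image, connectionEvent, Set.mem_ofPred_eq,
      openSubgraph_layeredConfig]
    simp
  rw [e, Set.ncard_image_of_injective _ layeredConfig_bijective.injective, Set.ncard_coe_finset]
  simp_rw [Finset.card_filter, Fintype.sum_prod_type]

theorem ncard_connectionEvent_le [Fintype V] (x y : V) :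
    (connectionEvent (bunkbed (completeGraph V)) (x, 0) (y, 1)).ncard ≤
      (connectionEvent (bunkbed (completeGraph V)) (x, 0) (y, 0)).ncard := by
  classical
  rw [ncard_connectionEvent, ncard_connectionEvent]
  exact Finset.sum_le_sum fun H _ => card_layered_reachable_le H x y

end Configurations

/-! ### From the product measure at 1/2 to counting. -/

theorem bernoulliMeasure_half_singleton (b : Bool) :
    bernoulliMeasure true false ⟨1 / 2, by norm_num, by norm_num⟩ {b} = 1 / 2 := by
  have h : ∀ p : unitInterval, (p : ℝ) = 1 / 2 →
      ((unitInterval.toNNReal p : NNReal) : ENNReal) = 1 / 2 := by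
    intro p hp
    have : unitInterval.toNNReal p = 1 / 2 := NNReal.eq (by simpa using hp)
    simp [this]
  rw [bernoulliMeasure_apply _ (measurableSet_singleton b)]
  cases b
  · simpa using h (unitInterval.symm ⟨1 / 2, by norm_num, by norm_num⟩) (by norm_num)
  · simpa using h ⟨1 / 2, by norm_num, by norm_num⟩ rfl

theorem bondPercolation_half_apply {V : Type*} [Finite V] (G : SimpleGraph V)
    (S : Set (BondConfig G)) :
    bondPercolation G ⟨1 / 2, by norm_num, by norm_num⟩ S =
      S.ncard * (1 / 2) ^ Nat.card G.edgeSet := by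
  classical
  have := Fintype.ofFinite G.edgeSet
  have h : ∀ ω : BondConfig G, bondPercolation G ⟨1 / 2, by norm_num, by norm_num⟩ {ω} =
      (1 / 2) ^ Nat.card G.edgeSet := by
    intro ω
    rw [bondPercolation, Measure.infinitePi_eq_pi, Measure.pi_singleton,
      Nat.card_eq_fintype_card, ← Finset.card_univ]
    exact Finset.prod_eq_pow_card fun e _ => bernoulliMeasure_half_singleton (ω e)
  obtain ⟨T, rfl⟩ := S.toFinite.exists_finset_coe
  rw [← sum_measure_singleton, Finset.sum_congr rfl fun ω _ => h ω, Finset.sum_const, nsmul_eq_mul,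
    Set.ncard_coe_finset]

theorem theorem1 (n : ℕ) (x y : Fin n) :
    bondPercolation (bunkbed (SimpleGraph.completeGraph (Fin n))) ⟨1 / 2, by norm_num, by norm_num⟩
        (connectionEvent (bunkbed (SimpleGraph.completeGraph (Fin n))) (x, 0) (y, 0)) ≥
      bondPercolation (bunkbed (SimpleGraph.completeGraph (Fin n))) ⟨1 / 2, by norm_num, by norm_num⟩
        (connectionEvent (bunkbed (SimpleGraph.completeGraph (Fin n))) (x, 0) (y, 1)) := by
  rw [bondPercolation_half_apply, bondPercolation_half_apply]
  gcongr ?_ * _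
  exact Nat.cast_le.2 (ncard_connectionEvent_le x y)
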